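/- Let $K$ be an algebraically closed field (of any characteristic), let $B_3=\langle\sigma_1,\sigma_2\mid\sigma_1\sigma_2\sigma_1=\sigma_2\sigma_1\sigma_2\rangle$ be the braid group on three strands, and put $\zeta=(\sigma_1\sigma_2)^3$. Let $\pi:B_3\to SL(2,\mathbb Z)$ be the homomorphism with $\sigma_1\mapsto\begin{pmatrix}1&1\\0&1\end{pmatrix}$, $\sigma_2\mapsto\begin{pmatrix}1&0\\-1&1\end{pmatrix}$, and let $\bar\pi:B_3\to PSL(2,\mathbb Z)=SL(2,\mathbb Z)/\{\pm1\}$ be its composition with the projection. All modules are finite-dimensional over $K$. On every simple $B_3$-module $V$ of dimension $d$ the element $\zeta$ acts as multiplication by a unique scalar $\delta\in K$, and $\delta^d=\det(A)^6$, where $A$ is the endomorphism by which $\sigma_1$ acts on $V$. Moreover: (a) On each $K$-vector space $V$ of finite dimension (in particular of dimension $\le 5$), restriction along $\pi$ is a bijection from the simple $SL(2,\mathbb Z)$-module structures on $V$ onto the simple $B_3$-module structures on $V$ with $\delta^2=1$. Two $SL(2,\mathbb Z)$-modules are isomorphic if and only if their restrictions along $\pi$ are isomorphic $B_3$-modules.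 (b) On each such $V$, restriction along $\bar\pi$ is a bijection from the simple $PSL(2,\mathbb Z)$-module structures on $V$ onto the simple $B_3$-module structures on $V$ with $\delta=1$. Two $PSL(2,\mathbb Z)$-modules are isomorphic if and only if their restrictions along $\bar\pi$ are isomorphic $B_3$-modules. (c) Let $V$ be a simple $B_3$-module of dimension $d$, and let $\lambda_1,\dots,\lambda_d$ be the eigenvalues of $A$, listed with algebraic multiplicity. If $d=2$, then $\delta=-(\lambda_1\lambda_2)^3$; if $d=3$, then $\delta=(\lambda_1\lambda_2\lambda_3)^2$. -/

import Mathlib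

open scoped MatrixGroups

namespace B3Rep

/-- The single defining relator `σ₁σ₂σ₁(σ₂σ₁σ₂)⁻¹` of `B₃`; `σ₁` is the generator `0`, `σ₂` the
generator `1`. -/
def braidRels : Set (FreeGroup (Fin 2)) :=
  {FreeGroup.of 0 * FreeGroup.of 1 * FreeGroup.of 0 *
    (FreeGroup.of 1 * FreeGroup.of 0 * FreeGroup.of 1)⁻¹}

/-- Artin's braid group on three strands. -/
abbrev B3 : Type := PresentedGroup braidRels

/-- The first standard generator of `B₃`. -/
def s1 : B3 := PresentedGroup.of 0

/-- The second standard generator of `B₃`. -/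
def s2 : B3 := PresentedGroup.of 1

/-- The element `ζ = (σ₁σ₂)³`, which generates the center of `B₃`. -/
def zeta : B3 := (s1 * s2) ^ 3

/-- The matrices `(1 1; 0 1)` and `(1 0; -1 1)`. -/
def slGen : Fin 2 → SL(2, ℤ) :=
  ![⟨!![1, 1; 0, 1], by simp [Matrix.det_fin_two]⟩,
    ⟨!![1, 0; -1, 1], by simp [Matrix.det_fin_two]⟩]

theorem slGen_rel : ∀ r ∈ braidRels, FreeGroup.lift slGen r = 1 := by
  intro r hr
  rw [braidRels, Set.mem_singleton_iff] at hr
  subst hr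
  simp only [map_mul, map_inv, FreeGroup.lift_apply_of]
  rw [mul_inv_eq_one]
  decide

/-- The homomorphism `B₃ → SL(2, ℤ)` with `σ₁ ↦ (1 1; 0 1)` and `σ₂ ↦ (1 0; -1 1)`. -/
def toSL : B3 →* SL(2, ℤ) := PresentedGroup.toGroup slGen_rel

/-- The composition of `toSL` with the projection `SL(2, ℤ) → PSL(2, ℤ)`. -/
def toPSL : B3 →* PSL(2, ℤ) :=
  (QuotientGroup.mk' (Subgroup.center SL(2, ℤ))).comp toSL

/-- The representation of `G` obtained from a representation of `H` by restriction along a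
homomorphism `G → H`. -/
def pullback {K G H V : Type*} [Field K] [Group G] [Group H] [AddCommGroup V] [Module K V]
    (f : G →* H) (τ : Representation K H V) : Representation K G V :=
  MonoidHom.comp τ f

/-- `ζ` acts on the `B₃`-module as multiplication by the scalar `δ`. -/
def HasCentralScalar {K V : Type*} [Field K] [AddCommGroup V] [Module K V]
    (ρ : Representation K B3 V) (δ : K) : Prop :=
  ρ zeta = δ • LinearMap.id

end B3Rep

/-! ### Identities in the braid group. -/

namespace B3Rep

/-! The elements `halfTwist` and `rot` generate `B3`, and `zeta` is both the square of the first and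
the cube of the second. So `zeta` is central, and Schur's lemma supplies `δ`; taking determinants in
`halfTwist ^ 2 = zeta` gives the formula for its power.

Parts (a) and (b) reduce to `ker_toSL` and `ker_toPSL`: restriction along a surjection identifies
the simple modules of the quotient with the simple modules on which the kernel acts trivially. The
kernels come from the normal form `isNormalForm` and the sign pattern `IsWord.entries`, which
together show that only powers of `zeta` map to `±1`.

For (c), the formula for `δ` says that the characteristic polynomial of `halfTwist` (`d = 2`) or
`rot` (`d = 3`) has the constant term of `X ^ d - δ`. Otherwise the minimal polynomial drops in
degree, the eigenspaces become so large that `halfTwist` and `rot` share an eigenvector, and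
simplicity forces `d = 1`. -/

theorem braid_rel : s1 * s2 * s1 = s2 * s1 * s2 := by
  have h := PresentedGroup.one_of_mem (rels := braidRels) (Set.mem_singleton _)
  rw [map_mul, map_inv, mul_inv_eq_one] at h
  exact h

theorem toSL_s1 : toSL s1 = slGen 0 := PresentedGroup.toGroup.of slGen_rel

theorem toSL_s2 : toSL s2 = slGen 1 := PresentedGroup.toGroup.of slGen_rel

/-- The half twist `σ₁σ₂σ₁`, a square root of `zeta`. -/
def halfTwist : B3 := s1 * s2 * s1

/-- The element `σ₁σ₂`, a cube root of `zeta`. -/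
def rot : B3 := s1 * s2

theorem rot_pow_three : rot ^ 3 = zeta := rfl

theorem halfTwist_sq : halfTwist ^ 2 = zeta := by
  have h : halfTwist ^ 2 = s1 * s2 * s1 * (s1 * s2 * s1) := pow_two _
  rw [h]
  nth_rewrite 2 [braid_rel]
  simp only [zeta, pow_succ, pow_zero, one_mul, mul_assoc]

theorem halfTwist_eq : halfTwist = s2 * rot := by
  rw [halfTwist, braid_rel, rot, mul_assoc]

theorem halfTwist_eq' : halfTwist = rot * s1 := rfl

theorem s1_eq : s1 = rot⁻¹ * halfTwist := by rw [halfTwist_eq', inv_mul_cancel_left]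

theorem s2_eq : s2 = halfTwist * rot⁻¹ := by rw [halfTwist_eq, mul_inv_cancel_right]

theorem halfTwist_mul_rot : halfTwist * rot = zeta * s1⁻¹ := by
  rw [eq_mul_inv_iff_mul_eq, mul_assoc, ← halfTwist_eq', ← pow_two, halfTwist_sq]

theorem closure_s1_s2 : Subgroup.closure ({s1, s2} : Set B3) = ⊤ := by
  rw [← PresentedGroup.closure_range_of]
  congr 1
  ext x
  simp [Fin.exists_fin_two, s1, s2, eq_comm]

theorem closure_halfTwist_rot : Subgroup.closure ({halfTwist, rot} : Set B3) = ⊤ := by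
  rw [eq_top_iff, ← closure_s1_s2, Subgroup.closure_le]
  have ha : halfTwist ∈ Subgroup.closure ({halfTwist, rot} : Set B3) :=
    Subgroup.subset_closure (by simp)
  have hb : rot ∈ Subgroup.closure ({halfTwist, rot} : Set B3) :=
    Subgroup.subset_closure (by simp)
  rintro x (rfl | rfl)
  · rw [s1_eq]; exact mul_mem (inv_mem hb) ha
  · rw [s2_eq]; exact mul_mem ha (inv_mem hb)

theorem zeta_mem_center : zeta ∈ Subgroup.center B3 := by
  have h : Subgroup.closure ({halfTwist, rot} : Set B3) ≤ Subgroup.centralizer {zeta} := by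
    rw [Subgroup.closure_le]
    rintro x (rfl | rfl) <;>
      simp only [SetLike.mem_coe, Subgroup.mem_centralizer_singleton_iff]
    · rw [← halfTwist_sq]; exact (Commute.pow_self _ 2).eq.symm
    · rw [← rot_pow_three]; exact (Commute.pow_self _ 3).eq.symm
  rw [closure_halfTwist_rot] at h
  rw [Subgroup.mem_center_iff]
  intro g
  exact Subgroup.mem_centralizer_singleton_iff.1 (h (Subgroup.mem_top g))

theorem commute_zeta_zpow (k : ℤ) (x : B3) : x * zeta ^ k = zeta ^ k * x :=
  Subgroup.mem_center_iff.1 (zpow_mem zeta_mem_center k) x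

/-! ### A normal form modulo the center. -/

/-- Membership in the submonoid of `B₃` generated by `σ₁⁻¹` and `σ₂`. -/
inductive IsWord : B3 → Prop
  | one : IsWord 1
  | s1_inv_mul {w : B3} : IsWord w → IsWord (s1⁻¹ * w)
  | s2_mul {w : B3} : IsWord w → IsWord (s2 * w)

/-- Elements of the form `ζᵏ rotⁱ w halfTwistʲ` with `i ≤ 2`, `j ≤ 1` and `w` a word in `σ₁⁻¹`
and `σ₂`. -/
def IsNormalForm (x : B3) : Prop :=
  ∃ (k : ℤ) (i j : ℕ) (w : B3), i < 3 ∧ j < 2 ∧ IsWord w ∧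
    x = zeta ^ k * (rot ^ i * w * halfTwist ^ j)

theorem IsNormalForm.zpow_mul {x : B3} (hx : IsNormalForm x) (k : ℤ) :
    IsNormalForm (zeta ^ k * x) := by
  obtain ⟨l, i, j, w, hi, hj, hw, rfl⟩ := hx
  exact ⟨k + l, i, j, w, hi, hj, hw, by simp only [zpow_add, mul_assoc]⟩

theorem isNormalForm_of_isWord {w : B3} (hw : IsWord w) {i j : ℕ} (hi : i < 3) (hj : j < 2) :
    IsNormalForm (rot ^ i * w * halfTwist ^ j) :=
  ⟨0, i, j, w, hi, hj, hw, by simp⟩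

theorem IsNormalForm.rot_mul {x : B3} (hx : IsNormalForm x) : IsNormalForm (rot * x) := by
  obtain ⟨l, i, j, w, hi, hj, hw, rfl⟩ := hx
  rw [← mul_assoc, commute_zeta_zpow, mul_assoc]
  refine IsNormalForm.zpow_mul ?_ l
  rw [mul_assoc, ← mul_assoc, ← pow_succ', ← mul_assoc]
  rcases Nat.lt_or_ge (i + 1) 3 with h | h
  · exact isNormalForm_of_isWord hw h hj
  · obtain rfl : i = 2 := by omega
    have := (isNormalForm_of_isWord hw (i := 0) (by omega) hj).zpow_mul 1
    simpa [rot_pow_three, mul_assoc] using this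

/-- Multiplication by `halfTwist` trades the exponent `i` against the first letter of the word: a
leading `σ₁⁻¹` or `σ₂` is absorbed into `rot` or `rot ^ 2` when `i = 0`, and `rot` or `rot ^ 2`
becomes a new letter, up to `zeta`, otherwise. The exponent `j` changes only for the empty word. -/
theorem IsNormalForm.halfTwist_mul {x : B3} (hx : IsNormalForm x) :
    IsNormalForm (halfTwist * x) := by
  obtain ⟨l, i, j, w, hi, hj, hw, rfl⟩ := hx
  rw [← mul_assoc, commute_zeta_zpow, mul_assoc]
  refine IsNormalForm.zpow_mul ?_ l
  have hz (x : B3) : x * zeta = zeta * x := Subgroup.mem_center_iff.1 zeta_mem_center x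
  interval_cases i
  · cases hw with
    | one =>
      interval_cases j
      · simpa using isNormalForm_of_isWord IsWord.one (i := 0) (j := 1) (by omega) (by omega)
      · have := (isNormalForm_of_isWord IsWord.one (i := 0) (j := 0) (by omega)
          (by omega)).zpow_mul 1
        simpa [← halfTwist_sq, pow_two] using this
    | @s1_inv_mul w hw =>
      have h : halfTwist * s1⁻¹ = rot := by rw [halfTwist_eq', mul_inv_cancel_right]
      have := isNormalForm_of_isWord hw (i := 1) (by omega) hj
      rw [pow_one, ← h] at this
      simpa [mul_assoc] using this
    | @s2_mul w hw =>
      have h : halfTwist * s2 = rot ^ 2 := by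
        rw [s2_eq, ← mul_assoc, ← pow_two, halfTwist_sq, ← rot_pow_three, pow_succ rot 2,
          mul_inv_cancel_right]
      have := isNormalForm_of_isWord hw (i := 2) (by omega) hj
      rw [← h] at this
      simpa [mul_assoc] using this
  · have := (isNormalForm_of_isWord hw.s1_inv_mul (i := 0) (by omega) hj).zpow_mul 1
    have h : zeta ^ (1 : ℤ) * (rot ^ 0 * (s1⁻¹ * w) * halfTwist ^ j) =
        zeta * s1⁻¹ * (w * halfTwist ^ j) := by simp [mul_assoc]
    rw [h, ← halfTwist_mul_rot] at this
    simpa [mul_assoc] using this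
  · have := (isNormalForm_of_isWord hw.s2_mul (i := 0) (by omega) hj).zpow_mul 1
    have h : halfTwist * rot ^ 2 = zeta * s2 := by
      rw [← hz, s2_eq, ← rot_pow_three, pow_succ' rot 2, mul_assoc, inv_mul_cancel_left]
    have h' : zeta ^ (1 : ℤ) * (rot ^ 0 * (s2 * w) * halfTwist ^ j) =
        zeta * s2 * (w * halfTwist ^ j) := by simp [mul_assoc]
    rw [h', ← h] at this
    simpa [mul_assoc] using this

theorem isNormalForm (x : B3) : IsNormalForm x := by
  have hx : x ∈ Subgroup.closure ({halfTwist, rot} : Set B3) := by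
    rw [closure_halfTwist_rot]; trivial
  have ha : halfTwist⁻¹ = zeta ^ (-1 : ℤ) * halfTwist := by
    rw [← halfTwist_sq]; group
  have hb : rot⁻¹ = zeta ^ (-1 : ℤ) * (rot * rot) := by
    rw [← rot_pow_three]; group
  induction hx using Subgroup.closure_induction_left with
  | one => simpa using isNormalForm_of_isWord IsWord.one (i := 0) (j := 0) (by omega) (by omega)
  | mul_left y hy z _ ih =>
    rcases hy with rfl | rfl
    · exact ih.halfTwist_mul
    · exact ih.rot_mul
  | inv_mul_cancel y hy z _ ih =>
    rcases hy with rfl | rfl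
    · rw [ha, mul_assoc]; exact ih.halfTwist_mul.zpow_mul _
    · rw [hb, mul_assoc, mul_assoc]; exact ih.rot_mul.rot_mul.zpow_mul _

/-! ### Images in `SL(2, ℤ)` and the two kernels. -/

theorem toSL_zeta : toSL zeta = -1 := by
  rw [zeta, map_pow, map_mul, toSL_s1, toSL_s2]; decide

theorem toSL_s1_inv_coe : ((toSL s1⁻¹ : SL(2, ℤ)) : Matrix (Fin 2) (Fin 2) ℤ) =
    !![1, -1; 0, 1] := by
  rw [map_inv, toSL_s1]; decide

theorem toSL_s2_coe : ((toSL s2 : SL(2, ℤ)) : Matrix (Fin 2) (Fin 2) ℤ) = !![1, 0; -1, 1] := by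
  rw [toSL_s2]; decide

theorem toSL_rot_coe : ((toSL rot : SL(2, ℤ)) : Matrix (Fin 2) (Fin 2) ℤ) =
    !![0, 1; -1, 1] := by
  rw [rot, map_mul, toSL_s1, toSL_s2]; decide

theorem toSL_halfTwist_coe : ((toSL halfTwist : SL(2, ℤ)) : Matrix (Fin 2) (Fin 2) ℤ) =
    !![0, 1; -1, 0] := by
  rw [halfTwist, map_mul, map_mul, toSL_s1, toSL_s2]; decide

/-- Each letter acts on the left by subtracting one row from the other, which preserves the signs
and makes an off-diagonal entry strictly negative for good. Hence only the empty word has a diagonal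
image. -/
theorem IsWord.entries {w : B3} (hw : IsWord w) :
    ∃ p q r s : ℤ, ((toSL w : SL(2, ℤ)) : Matrix (Fin 2) (Fin 2) ℤ) = !![p, q; r, s] ∧
      1 ≤ p ∧ q ≤ 0 ∧ r ≤ 0 ∧ 1 ≤ s ∧ (q = 0 → r = 0 → w = 1) := by
  induction hw with
  | one => exact ⟨1, 0, 0, 1, by simp [Matrix.one_fin_two], by simp⟩
  | @s1_inv_mul w _ ih =>
    obtain ⟨p, q, r, s, h, hp, hq, hr, hs, -⟩ := ih
    refine ⟨p - r, q - s, r, s, ?_, by omega, by omega, hr, hs, by omega⟩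
    rw [map_mul, Matrix.SpecialLinearGroup.coe_mul, toSL_s1_inv_coe, h]
    simp; constructor <;> ring
  | @s2_mul w _ ih =>
    obtain ⟨p, q, r, s, h, hp, hq, hr, hs, -⟩ := ih
    refine ⟨p, q, r - p, s - q, ?_, hp, hq, by omega, by omega, by omega⟩
    rw [map_mul, Matrix.SpecialLinearGroup.coe_mul, toSL_s2_coe, h]
    simp; constructor <;> ring

theorem toSL_zeta_zpow (k : ℤ) : toSL (zeta ^ k) = 1 ∨ toSL (zeta ^ k) = -1 := by
  rw [map_zpow, toSL_zeta]
  rcases Int.even_or_odd k with h | h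
  · exact .inl h.neg_one_zpow
  · exact .inr h.neg_one_zpow

theorem mem_zpowers_zeta {x : B3} (hx : toSL x = 1 ∨ toSL x = -1) :
    x ∈ Subgroup.zpowers zeta := by
  obtain ⟨k, i, j, w, hi, hj, hw, rfl⟩ := isNormalForm x
  have h : toSL (rot ^ i * w * halfTwist ^ j) = 1 ∨ toSL (rot ^ i * w * halfTwist ^ j) = -1 := by
    rw [map_mul] at hx
    rcases toSL_zeta_zpow k with hk | hk <;> rw [hk] at hx
    · simpa using hx
    · rw [neg_one_mul, neg_inj, neg_eq_iff_eq_neg] at hx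
      exact hx.symm
  obtain ⟨p, q, r, s, hM, hp, hq, hr, hs, hw1⟩ := hw.entries
  have h' : ∃ e : ℤ, (e = 1 ∨ e = -1) ∧
      ((toSL (rot ^ i * w * halfTwist ^ j) : SL(2, ℤ)) : Matrix (Fin 2) (Fin 2) ℤ) =
        !![e, 0; 0, e] := by
    rcases h with h | h <;> rw [h]
    · exact ⟨1, .inl rfl, by decide⟩
    · exact ⟨-1, .inr rfl, by decide⟩
  obtain ⟨e, he, h'⟩ := h'
  rw [map_mul, map_mul, map_pow, map_pow, Matrix.SpecialLinearGroup.coe_mul,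
    Matrix.SpecialLinearGroup.coe_mul, Matrix.SpecialLinearGroup.coe_pow,
    Matrix.SpecialLinearGroup.coe_pow, toSL_rot_coe, toSL_halfTwist_coe, hM] at h'
  -- Unless `i = j = 0`, the sign pattern makes some off-diagonal entry of the product nonzero.
  have hij : i = 0 ∧ j = 0 ∧ w = 1 := by
    interval_cases i <;> interval_cases j <;>
      simp [pow_two, Matrix.one_fin_two] at h' <;>
      grind
  obtain ⟨rfl, rfl, rfl⟩ := hij
  simp

theorem mem_ker_toPSL_iff {x : B3} :
    x ∈ toPSL.ker ↔ toSL x = 1 ∨ toSL x = -1 := by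
  rw [MonoidHom.mem_ker, toPSL, MonoidHom.comp_apply, QuotientGroup.mk'_apply,
    QuotientGroup.eq_one_iff, Matrix.SpecialLinearGroup.mem_center_iff]
  constructor
  · rintro ⟨r, hr, h⟩
    rw [Fintype.card_fin] at hr
    rcases eq_or_eq_neg_of_sq_eq_sq r 1 (by rw [hr, one_pow]) with rfl | rfl
    · exact .inl (Subtype.ext (by rw [← h]; simp))
    · exact .inr (Subtype.ext (by rw [← h]; simp))
  · rintro (h | h) <;> rw [h]
    · exact ⟨1, by simp, by simp⟩
    · exact ⟨-1, by simp, by simp⟩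

theorem ker_toPSL : toPSL.ker = Subgroup.zpowers zeta := by
  ext x
  rw [mem_ker_toPSL_iff]
  refine ⟨mem_zpowers_zeta, ?_⟩
  rintro ⟨k, rfl⟩
  exact toSL_zeta_zpow k

theorem ker_toSL : toSL.ker = Subgroup.zpowers (zeta ^ 2) := by
  ext x
  rw [MonoidHom.mem_ker]
  constructor
  · intro hx
    obtain ⟨k, rfl⟩ := mem_zpowers_zeta (.inl hx)
    change toSL (zeta ^ k) = 1 at hx
    rw [map_zpow, toSL_zeta] at hx
    rcases Int.even_or_odd k with ⟨m, rfl⟩ | h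
    · refine ⟨m, ?_⟩
      change (zeta ^ 2) ^ m = zeta ^ (m + m)
      rw [← two_mul, zpow_mul]; rfl
    · rw [h.neg_one_zpow] at hx
      exact absurd hx (by decide)
  · rintro ⟨k, rfl⟩
    change toSL ((zeta ^ 2) ^ k) = 1
    rw [map_zpow, map_pow, toSL_zeta, neg_one_sq, one_zpow]

theorem toSL_surjective : Function.Surjective toSL := by
  rw [← MonoidHom.range_eq_top, eq_top_iff, ← SpecialLinearGroup.SL2Z_generators,
    Subgroup.closure_le]
  rintro x (rfl | rfl)
  · exact ⟨halfTwist⁻¹, by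
      rw [map_inv, halfTwist, map_mul, map_mul, toSL_s1, toSL_s2]; decide⟩
  · exact ⟨s1, by rw [toSL_s1]; decide⟩

theorem toPSL_surjective : Function.Surjective toPSL :=
  (QuotientGroup.mk'_surjective _).comp toSL_surjective

/-! ### Restriction along a surjection. -/

section Pullback

variable {K G H V W : Type*} [Field K] [Group G] [Group H] [AddCommGroup V] [Module K V]
  [AddCommGroup W] [Module K W] {f : G →* H}

@[simp]
theorem pullback_apply (f : G →* H) (τ : Representation K H V) (g : G) :
    pullback f τ g = τ (f g) := rfl

/-- Restriction along a surjective homomorphism does not change the subrepresentations. -/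
def subrepresentationPullback (hf : Function.Surjective f) (τ : Representation K H V) :
    Subrepresentation (pullback f τ) ≃o Subrepresentation τ where
  toFun S := ⟨S.toSubmodule, fun h v hv => by
    obtain ⟨g, rfl⟩ := hf h
    exact S.apply_mem_toSubmodule g hv⟩
  invFun S := ⟨S.toSubmodule, fun g _ hv => S.apply_mem_toSubmodule (f g) hv⟩
  left_inv _ := rfl
  right_inv _ := rfl
  map_rel_iff' := Iff.rfl

theorem isIrreducible_pullback_iff (hf : Function.Surjective f) (τ : Representation K H V) :
    (pullback f τ).IsIrreducible ↔ τ.IsIrreducible :=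
  (subrepresentationPullback hf τ).isSimpleOrder_iff

theorem pullback_injective (hf : Function.Surjective f) :
    Function.Injective (pullback f : Representation K H V → Representation K G V) := by
  intro τ τ' h
  refine MonoidHom.ext fun x => ?_
  obtain ⟨g, rfl⟩ := hf x
  exact DFunLike.congr_fun h g

theorem exists_pullback_eq (hf : Function.Surjective f) (ρ : Representation K G V)
    (h : f.ker ≤ MonoidHom.ker ρ) : ∃ τ : Representation K H V, pullback f τ = ρ := by
  have key : ∀ x y : G, f x = f y → ρ x = ρ y := fun x y hxy => by
    have hmem : ρ (y⁻¹ * x) = 1 :=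
      h (by rw [MonoidHom.mem_ker, map_mul, map_inv, hxy, inv_mul_cancel])
    rw [← mul_inv_cancel_left y x, map_mul, hmem, mul_one]
  refine ⟨⟨⟨fun x => ρ (Function.surjInv hf x), ?_⟩, ?_⟩, ?_⟩
  · rw [← map_one ρ]
    exact key _ _ (by rw [Function.surjInv_eq hf, map_one])
  · intro x y
    dsimp only
    rw [← map_mul]
    exact key _ _ (by simp only [Function.surjInv_eq, map_mul])
  · exact MonoidHom.ext fun g => key _ _ (Function.surjInv_eq hf _)

theorem nonempty_equiv_pullback_iff (hf : Function.Surjective f) (τ : Representation K H V)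
    (τ' : Representation K H W) :
    Nonempty (τ.Equiv τ') ↔ Nonempty ((pullback f τ).Equiv (pullback f τ')) := by
  constructor
  · rintro ⟨e⟩
    exact ⟨.mk e.toLinearEquiv fun g => e.isIntertwining' (f g)⟩
  · rintro ⟨e⟩
    refine ⟨.mk e.toLinearEquiv fun h => ?_⟩
    obtain ⟨g, rfl⟩ := hf h
    exact e.isIntertwining' g

/-- Restriction along a surjective homomorphism whose kernel is generated by one element. -/
theorem bijOn_pullback (hf : Function.Surjective f) {z : G} (hz : f.ker = Subgroup.zpowers z) :
    Set.BijOn (pullback f) {τ : Representation K H V | τ.IsIrreducible}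
      {ρ : Representation K G V | ρ.IsIrreducible ∧ ρ z = 1} := by
  refine ⟨fun τ hτ => ⟨(isIrreducible_pullback_iff hf τ).2 hτ, ?_⟩,
    (pullback_injective hf).injOn, ?_⟩
  · have : f z = 1 := by
      rw [← MonoidHom.mem_ker, hz]; exact Subgroup.mem_zpowers z
    rw [pullback_apply, this, map_one]
  · rintro ρ ⟨hρ, h⟩
    obtain ⟨τ, rfl⟩ := exists_pullback_eq hf ρ (by
      rw [hz, Subgroup.zpowers_le]; exact h)
    exact ⟨τ, (isIrreducible_pullback_iff hf τ).1 hρ, rfl⟩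

end Pullback

/-! ### Simple modules: Schur's lemma and common eigenvectors. -/

section Irreducible

variable {K G V : Type*} [Field K] [Group G] [AddCommGroup V] [Module K V]
  {ρ : Representation K G V}

theorem nontrivial_of_isIrreducible (hρ : ρ.IsIrreducible) : Nontrivial V := by
  by_contra h
  rw [not_nontrivial_iff_subsingleton] at h
  have := hρ.toNontrivial
  exact bot_ne_top (α := Subrepresentation ρ)
    (Subrepresentation.toSubmodule_injective (Subsingleton.elim _ _))

theorem exists_eq_smul_id_of_mem_center [IsAlgClosed K] [FiniteDimensional K V]
    (hρ : ρ.IsIrreducible) {z : G} (hz : z ∈ Subgroup.center G) :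
    ∃ c : K, ρ z = c • LinearMap.id := by
  let φ : Representation.IntertwiningMap ρ ρ := ⟨ρ z, fun g => by
    rw [← Module.End.mul_eq_comp, ← Module.End.mul_eq_comp, ← map_mul, ← map_mul,
      Subgroup.mem_center_iff.1 hz g]⟩
  obtain ⟨c, hc⟩ :=
    (Representation.IsIrreducible.algebraMap_intertwiningMap_bijective_of_isAlgClosed
      (ρ := ρ)).2 φ
  refine ⟨c, ?_⟩
  have := congrArg Representation.IntertwiningMap.toLinearMap hc
  exact this.symm

theorem isIrreducible_eq_top {S : Submodule K V} (hρ : ρ.IsIrreducible)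
    (hS : ∀ g, ∀ v ∈ S, ρ g v ∈ S) (hne : S ≠ ⊥) : S = ⊤ := by
  rcases hρ.eq_bot_or_eq_top ⟨S, fun g v hv => hS g v hv⟩ with h | h
  · exact absurd (congrArg Subrepresentation.toSubmodule h) hne
  · exact congrArg Subrepresentation.toSubmodule h

/-- A simple module containing a common eigenvector of a generating set is a line. -/
theorem finrank_eq_one_of_common_eigenvector (hρ : ρ.IsIrreducible) {s : Set G}
    (hs : Subgroup.closure s = ⊤) {v : V} (hv : v ≠ 0)
    (h : ∀ g ∈ s, ∃ c : K, ρ g v = c • v) : Module.finrank K V = 1 := by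
  have key : ∀ g : G, ∃ c : K, ρ g v = c • v := fun g => by
    have hg : g ∈ Subgroup.closure s := hs ▸ Subgroup.mem_top g
    induction hg using Subgroup.closure_induction with
    | mem x hx => exact h x hx
    | one => exact ⟨1, by simp⟩
    | mul x y _ _ hx hy =>
      obtain ⟨c, hc⟩ := hx
      obtain ⟨d, hd⟩ := hy
      exact ⟨d * c, by rw [map_mul, Module.End.mul_apply, hd, map_smul, hc, mul_smul]⟩
    | inv x _ hx =>
      obtain ⟨c, hc⟩ := hx
      have hinv : v = c • ρ x⁻¹ v := by
        rw [← map_smul, ← hc, ← Module.End.mul_apply, ← map_mul, inv_mul_cancel, map_one,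
          Module.End.one_apply]
      have hc0 : c ≠ 0 := by
        rintro rfl
        exact hv (by rw [hinv, zero_smul])
      exact ⟨c⁻¹, by rw [eq_inv_smul_iff₀ hc0, ← hinv]⟩
  have htop : K ∙ v = ⊤ := isIrreducible_eq_top hρ (fun g w hw => by
    obtain ⟨a, rfl⟩ := Submodule.mem_span_singleton.1 hw
    obtain ⟨c, hc⟩ := key g
    rw [map_smul, hc]
    exact Submodule.smul_mem _ _ (Submodule.smul_mem _ _ (Submodule.mem_span_singleton_self v)))
    (by rwa [Ne, Submodule.span_singleton_eq_bot])
  rw [← finrank_top, ← htop, finrank_span_singleton hv]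

end Irreducible

/-! ### Minimal polynomials of small degree and large eigenspaces. -/

section LinearAlgebra

open Polynomial Module

variable {K V : Type*} [Field K] [AddCommGroup V] [Module K V] [FiniteDimensional K V]

/-- Both the characteristic polynomial and `X ^ n - c` annihilate `f`. Their difference has degree
below `n`, and it is nonzero because the determinant condition separates the constant terms. -/
theorem natDegree_minpoly_lt_of_pow_eq [Nontrivial V] {f : End K V} {c : K}
    (hf : f ^ finrank K V = c • LinearMap.id)
    (hc : LinearMap.det f ≠ (-1) ^ finrank K V * -c) :
    (minpoly K f).natDegree < finrank K V := by
  set n := finrank K V with hn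
  have hn0 : n ≠ 0 := (finrank_pos (R := K) (M := V)).ne'
  have hmon : (X ^ n - C c : K[X]).Monic := monic_X_pow_sub_C c hn0
  have hdeg : f.charpoly.degree = (X ^ n - C c : K[X]).degree := by
    rw [degree_X_pow_sub_C (Nat.pos_of_ne_zero hn0), degree_eq_natDegree f.charpoly_monic.ne_zero,
      LinearMap.charpoly_natDegree]
  set q := f.charpoly - (X ^ n - C c) with hq
  have hq0 : q ≠ 0 := fun h => hc (by
    rw [LinearMap.det_eq_sign_charpoly_coeff, sub_eq_zero.1 h, ← hn]
    simp [hn0.symm])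
  have hqdeg : q.degree < n := by
    have := degree_sub_lt_left hdeg f.charpoly_monic.ne_zero (by
      rw [f.charpoly_monic.leadingCoeff, hmon.leadingCoeff])
    rwa [hdeg, degree_X_pow_sub_C (Nat.pos_of_ne_zero hn0)] at this
  have haeval : aeval f q = 0 := by
    rw [hq, map_sub, LinearMap.aeval_self_charpoly, map_sub, map_pow, aeval_X, aeval_C, hf,
      Algebra.algebraMap_eq_smul_one]
    simp [Module.End.one_eq_id]
  have := (degree_le_of_dvd (minpoly.dvd K f haeval) hq0).trans_lt hqdeg
  exact (natDegree_lt_iff_degree_lt (minpoly.ne_zero (Algebra.IsIntegral.isIntegral f))).2 this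

theorem exists_eq_smul_id_of_natDegree_minpoly_le_one {f : End K V}
    (h : (minpoly K f).natDegree ≤ 1) : ∃ c : K, f = c • LinearMap.id := by
  have hm := minpoly.monic (Algebra.IsIntegral.isIntegral (R := K) f)
  have h0 := minpoly.aeval K f
  rcases Nat.le_one_iff_eq_zero_or_eq_one.1 h with h | h
  · rw [hm.natDegree_eq_zero.1 h, map_one] at h0
    exact ⟨0, by rw [← mul_one f, h0, mul_zero, zero_smul]⟩
  · rw [hm.eq_X_add_C h, map_add, aeval_X, aeval_C, Algebra.algebraMap_eq_smul_one] at h0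
    exact ⟨-(minpoly K f).coeff 0, by rw [neg_smul]; exact eq_neg_of_add_eq_zero_left h0⟩

/-- The range of `f - b` lies in the kernel of `f - a`, so by rank-nullity one of the two
eigenspaces has at least half the dimension. Equal `a` and `b` are allowed, so diagonalizability is
not needed. -/
theorem exists_le_two_mul_finrank_eigenspace {f : End K V} {a b : K}
    (h : (f - algebraMap K (End K V) a) * (f - algebraMap K (End K V) b) = 0) :
    ∃ c : K, finrank K V ≤ 2 * finrank K (f.eigenspace c) := by
  have h1 : LinearMap.range (f - algebraMap K (End K V) b) ≤ f.eigenspace a := by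
    rw [End.eigenspace_def]
    exact LinearMap.range_le_ker_iff.2 h
  have h2 := LinearMap.finrank_range_add_finrank_ker (f - algebraMap K (End K V) b)
  rw [Algebra.algebraMap_eq_smul_one b] at h1 h2
  rw [← End.eigenspace_def] at h2
  have h3 := Submodule.finrank_mono h1
  by_contra! hc
  have := hc a
  have := hc b
  omega

theorem exists_le_two_mul_finrank_eigenspace_of_natDegree_minpoly_le_two [IsAlgClosed K]
    [Nontrivial V] {f : End K V} (h : (minpoly K f).natDegree ≤ 2) :
    ∃ c : K, finrank K V ≤ 2 * finrank K (f.eigenspace c) := by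
  have hm := minpoly.monic (Algebra.IsIntegral.isIntegral (R := K) f)
  obtain ⟨a, ha⟩ := End.exists_eigenvalue f
  obtain ⟨r, hr⟩ := dvd_iff_isRoot.2 (End.isRoot_of_hasEigenvalue ha)
  have hrm : r.Monic := (monic_X_sub_C a).of_mul_monic_left (hr ▸ hm)
  have hdeg : (minpoly K f).natDegree = 1 + r.natDegree := by
    rw [hr, (monic_X_sub_C a).natDegree_mul hrm, natDegree_X_sub_C]
  have h0 := minpoly.aeval K f
  rw [hr, map_mul, map_sub, aeval_X, aeval_C] at h0
  rcases Nat.le_one_iff_eq_zero_or_eq_one.1 (show r.natDegree ≤ 1 by omega) with h | h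
  · rw [hrm.natDegree_eq_zero.1 h, map_one, mul_one] at h0
    exact exists_le_two_mul_finrank_eigenspace (a := a) (b := a) (by rw [h0, mul_zero])
  · rw [hrm.eq_X_add_C h, map_add, aeval_X, aeval_C] at h0
    exact exists_le_two_mul_finrank_eigenspace (a := a) (b := -r.coeff 0)
      (by rw [map_neg, sub_neg_eq_add, h0])

end LinearAlgebra

/-! ### The central scalar in dimensions two and three. -/

section Braid

open Module

variable {K V : Type*} [Field K] [AddCommGroup V] [Module K V] {ρ : Representation K B3 V} {δ : K}

theorem s2_eq_conj : s2 = rot * s1 * rot⁻¹ := by rw [← halfTwist_eq', s2_eq]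

theorem det_s2 (ρ : Representation K B3 V) : LinearMap.det (ρ s2) = LinearMap.det (ρ s1) := by
  rw [s2_eq_conj, map_mul, map_mul, map_mul, map_mul, mul_right_comm, ← map_mul, ← map_mul ρ,
    mul_inv_cancel, map_one, map_one, one_mul]

theorem det_halfTwist (ρ : Representation K B3 V) :
    LinearMap.det (ρ halfTwist) = LinearMap.det (ρ s1) ^ 3 := by
  rw [halfTwist, map_mul, map_mul, map_mul, map_mul, det_s2]; ring

theorem det_rot (ρ : Representation K B3 V) :
    LinearMap.det (ρ rot) = LinearMap.det (ρ s1) ^ 2 := by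
  rw [rot, map_mul, map_mul, det_s2]; ring

theorem HasCentralScalar.halfTwist_sq (h : HasCentralScalar ρ δ) :
    ρ halfTwist ^ 2 = δ • LinearMap.id := by
  rw [← map_pow, B3Rep.halfTwist_sq]; exact h

theorem HasCentralScalar.rot_pow_three (h : HasCentralScalar ρ δ) :
    ρ rot ^ 3 = δ • LinearMap.id := by
  rw [← map_pow, B3Rep.rot_pow_three]; exact h

theorem HasCentralScalar.unique [Nontrivial V] {ε : K} (h : HasCentralScalar ρ δ)
    (h' : HasCentralScalar ρ ε) : δ = ε := by
  obtain ⟨v, hv⟩ := exists_ne (0 : V)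
  exact smul_left_injective K hv (LinearMap.congr_fun (h.symm.trans h') v)

theorem HasCentralScalar.pow_finrank (h : HasCentralScalar ρ δ) :
    δ ^ finrank K V = LinearMap.det (ρ s1) ^ 6 := by
  have := congrArg LinearMap.det h.halfTwist_sq
  rw [map_pow, det_halfTwist, LinearMap.det_smul, LinearMap.det_id, mul_one, ← pow_mul] at this
  exact this.symm

theorem HasCentralScalar.pow_apply_eq_one_iff [Nontrivial V] (h : HasCentralScalar ρ δ) (n : ℕ) :
    ρ (zeta ^ n) = 1 ↔ δ ^ n = 1 := by
  have : ρ (zeta ^ n) = algebraMap K (End K V) (δ ^ n) := by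
    rw [map_pow, h, map_pow]; rfl
  rw [this, ← map_one (algebraMap K (End K V))]
  exact (FaithfulSMul.algebraMap_injective K (End K V)).eq_iff

theorem finrank_eq_one_of_eigenspaces_meet (hρ : ρ.IsIrreducible) {c d : K} {v : V} (hv : v ≠ 0)
    (hc : v ∈ End.eigenspace (ρ halfTwist) c) (hd : v ∈ End.eigenspace (ρ rot) d) :
    finrank K V = 1 := by
  refine finrank_eq_one_of_common_eigenvector hρ closure_halfTwist_rot hv ?_
  rintro g (rfl | rfl)
  · exact ⟨c, End.mem_eigenspace_iff.1 hc⟩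
  · exact ⟨d, End.mem_eigenspace_iff.1 hd⟩

variable [IsAlgClosed K] [FiniteDimensional K V]

/-- If the formula failed, `halfTwist` would act as a scalar, and any eigenvector of `rot` would
span an invariant line. -/
theorem HasCentralScalar.eq_of_finrank_eq_two (hρ : ρ.IsIrreducible) (h : HasCentralScalar ρ δ)
    (hd : finrank K V = 2) : δ = -LinearMap.det (ρ s1) ^ 3 := by
  have := nontrivial_of_isIrreducible hρ
  by_contra hne
  have hlt := natDegree_minpoly_lt_of_pow_eq (f := ρ halfTwist) (c := δ)
    (by rw [hd, h.halfTwist_sq])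
    (by rw [hd, det_halfTwist]; intro he; exact hne (by rw [he]; ring))
  obtain ⟨c, hc⟩ := exists_eq_smul_id_of_natDegree_minpoly_le_one (f := ρ halfTwist) (by omega)
  obtain ⟨d, hd'⟩ := End.exists_eigenvalue (ρ rot)
  obtain ⟨v, hv⟩ := hd'.exists_hasEigenvector
  have := finrank_eq_one_of_eigenspaces_meet hρ hv.2 (c := c)
    (End.mem_eigenspace_iff.2 (by rw [hc]; rfl)) hv.1
  omega

/-- If the formula failed, `rot` and `halfTwist` would each have an eigenspace of dimension at least
two, and two such subspaces of a three-dimensional space meet. -/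
theorem HasCentralScalar.eq_of_finrank_eq_three (hρ : ρ.IsIrreducible)
    (h : HasCentralScalar ρ δ) (hd : finrank K V = 3) : δ = LinearMap.det (ρ s1) ^ 2 := by
  have := nontrivial_of_isIrreducible hρ
  by_contra hne
  have hlt := natDegree_minpoly_lt_of_pow_eq (f := ρ rot) (c := δ)
    (by rw [hd, h.rot_pow_three])
    (by rw [hd, det_rot]; intro he; exact hne (by rw [he]; ring))
  obtain ⟨b, hb⟩ := exists_le_two_mul_finrank_eigenspace_of_natDegree_minpoly_le_two
    (f := ρ rot) (by omega)
  -- `halfTwist` is a root of `(X - e) * (X + e)`; in characteristic two the factors coincide, which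
  -- is harmless.
  obtain ⟨e, he⟩ := IsAlgClosed.exists_pow_nat_eq δ (n := 2) (by norm_num)
  obtain ⟨a, ha⟩ := exists_le_two_mul_finrank_eigenspace (f := ρ halfTwist) (a := e) (b := -e) (by
    have hcomm : Commute (ρ halfTwist) (algebraMap K (End K V) e) :=
      (Algebra.commutes e (ρ halfTwist)).symm
    rw [map_neg, sub_neg_eq_add, ← hcomm.mul_self_sub_mul_self_eq', ← pow_two, ← pow_two,
      h.halfTwist_sq, ← map_pow, he, Algebra.algebraMap_eq_smul_one]
    exact sub_self _)
  have hsum := Submodule.finrank_sup_add_finrank_inf_eq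
    (End.eigenspace (ρ halfTwist) a) (End.eigenspace (ρ rot) b)
  have hle := Submodule.finrank_le (End.eigenspace (ρ halfTwist) a ⊔ End.eigenspace (ρ rot) b)
  have hpos : End.eigenspace (ρ halfTwist) a ⊓ End.eigenspace (ρ rot) b ≠ ⊥ := by
    intro hbot
    rw [hbot, finrank_bot] at hsum
    omega
  obtain ⟨v, hv, hv0⟩ := Submodule.exists_mem_ne_zero_of_ne_bot hpos
  have := finrank_eq_one_of_eigenspaces_meet hρ hv0 hv.1 hv.2
  omega

theorem isIrreducible_and_centralScalar_iff (n : ℕ) (ρ : Representation K B3 V) :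
    (ρ.IsIrreducible ∧ ρ (zeta ^ n) = 1) ↔
      (ρ.IsIrreducible ∧ ∃ δ : K, HasCentralScalar ρ δ ∧ δ ^ n = 1) := by
  refine and_congr_right fun hρ => ?_
  have := nontrivial_of_isIrreducible hρ
  obtain ⟨δ, hδ⟩ := exists_eq_smul_id_of_mem_center hρ zeta_mem_center
  exact ⟨fun h => ⟨δ, hδ, (HasCentralScalar.pow_apply_eq_one_iff hδ n).1 h⟩,
    fun ⟨ε, hε, h⟩ => (hε.pow_apply_eq_one_iff n).2 h⟩

end Braid

end B3Rep

theorem mainTheorem10 {K V : Type*} [Field K] [IsAlgClosed K]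
    [AddCommGroup V] [Module K V] [FiniteDimensional K V] :
    -- the central scalar of a simple `B₃`-module is well defined
    (∀ ρ : Representation K B3Rep.B3 V, ρ.IsIrreducible →
      (∃! δ : K, B3Rep.HasCentralScalar ρ δ) ∧
      ∀ δ : K, B3Rep.HasCentralScalar ρ δ →
        δ ^ Module.finrank K V = LinearMap.det (ρ B3Rep.s1) ^ 6) ∧
    -- simple `SL(2, ℤ)`-modules are the simple `B₃`-modules with `δ ^ 2 = 1`
    Set.BijOn (B3Rep.pullback B3Rep.toSL)
      {τ : Representation K SL(2, ℤ) V | τ.IsIrreducible}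
      {ρ : Representation K B3Rep.B3 V | ρ.IsIrreducible ∧
        ∃ δ : K, B3Rep.HasCentralScalar ρ δ ∧ δ ^ 2 = 1} ∧
    (∀ {W : Type*} [AddCommGroup W] [Module K W] [FiniteDimensional K W]
      (τ : Representation K SL(2, ℤ) V) (τ' : Representation K SL(2, ℤ) W),
      Nonempty (τ.Equiv τ') ↔
        Nonempty ((B3Rep.pullback B3Rep.toSL τ).Equiv (B3Rep.pullback B3Rep.toSL τ'))) ∧
    -- simple `PSL(2, ℤ)`-modules are the simple `B₃`-modules with `δ = 1`
    Set.BijOn (B3Rep.pullback B3Rep.toPSL)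
      {τ : Representation K PSL(2, ℤ) V | τ.IsIrreducible}
      {ρ : Representation K B3Rep.B3 V | ρ.IsIrreducible ∧
        ∃ δ : K, B3Rep.HasCentralScalar ρ δ ∧ δ = 1} ∧
    (∀ {W : Type*} [AddCommGroup W] [Module K W] [FiniteDimensional K W]
      (τ : Representation K PSL(2, ℤ) V) (τ' : Representation K PSL(2, ℤ) W),
      Nonempty (τ.Equiv τ') ↔
        Nonempty ((B3Rep.pullback B3Rep.toPSL τ).Equiv (B3Rep.pullback B3Rep.toPSL τ'))) ∧
    -- the value of `δ` in dimensions two and three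
    (∀ ρ : Representation K B3Rep.B3 V, ρ.IsIrreducible →
      ∀ δ : K, B3Rep.HasCentralScalar ρ δ →
        (Module.finrank K V = 2 → ∀ l₁ l₂ : K,
          (LinearMap.charpoly (ρ B3Rep.s1)).roots = {l₁, l₂} →
            δ = -(l₁ * l₂) ^ 3) ∧
        (Module.finrank K V = 3 → ∀ l₁ l₂ l₃ : K,
          (LinearMap.charpoly (ρ B3Rep.s1)).roots = {l₁, l₂, l₃} →
            δ = (l₁ * l₂ * l₃) ^ 2)) := by
  refine ⟨fun ρ hρ => ⟨?_, fun δ hδ => hδ.pow_finrank⟩, ?_,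
    fun τ τ' => B3Rep.nonempty_equiv_pullback_iff B3Rep.toSL_surjective τ τ', ?_,
    fun τ τ' => B3Rep.nonempty_equiv_pullback_iff B3Rep.toPSL_surjective τ τ',
    fun ρ hρ δ hδ => ⟨fun hd l₁ l₂ hl => ?_, fun hd l₁ l₂ l₃ hl => ?_⟩⟩
  · have := B3Rep.nontrivial_of_isIrreducible hρ
    obtain ⟨δ, hδ⟩ := B3Rep.exists_eq_smul_id_of_mem_center hρ B3Rep.zeta_mem_center
    exact ⟨δ, hδ, fun ε hε => B3Rep.HasCentralScalar.unique hε hδ⟩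
  · simpa only [B3Rep.isIrreducible_and_centralScalar_iff] using
      B3Rep.bijOn_pullback (K := K) (V := V) B3Rep.toSL_surjective B3Rep.ker_toSL
  -- Writing `zeta` as `zeta ^ 1` lets the criterion for `δ ^ n = 1` apply with `n = 1`.
  · have h := B3Rep.bijOn_pullback (K := K) (V := V) B3Rep.toPSL_surjective
      (B3Rep.ker_toPSL.trans (by rw [pow_one] : _ = Subgroup.zpowers (B3Rep.zeta ^ 1)))
    simp only [B3Rep.isIrreducible_and_centralScalar_iff] at h
    simpa only [pow_one] using h
  · rw [hδ.eq_of_finrank_eq_two hρ hd,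
      Module.End.det_eq_prod_roots_charpoly_of_splits (IsAlgClosed.splits _), hl]
    simp
  · rw [hδ.eq_of_finrank_eq_three hρ hd,
      Module.End.det_eq_prod_roots_charpoly_of_splits (IsAlgClosed.splits _), hl]
    simp [mul_assoc]
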